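/- For a finite non-empty vertex set $V$ and a graph $G=(V,E)$, the (lazy) simple random walk on $G$ is the process $X_0,X_1,\ldots$ in which $X_0$ is uniform on $V$ and, given $X_0,\dots,X_s$, the vertex $X_{s+1}$ is uniform on $\{X_s\}\cup N(X_s)$. Its trace $\Gamma_t$ is the simple graph on $V$ with edge set $\{\{X_{s-1},X_s\} : 0<s\le t,\ X_{s-1}\ne X_s\}$. A trail is a walk whose edges are distinct, and the trail decomposition number $\rho(H)$ of a graph $H$ is the minimum number of pairwise edge-disjoint trails in $H$ whose union is the edge set of $H$. We write $H\subseteq\Gamma$ if $\Gamma$ contains a (not necessarily induced) copy of $H$; for a non-negative $f$ and a positive $g$, $f\ll g$ means $f/g\to0$ and $f\gg g$ means $f/g\to\infty$ as $n\to\infty$. **Theorem.** Let $T$ be a fixed tree on at least $2$ vertices, let $\theta$ be the number of its vertices of odd degree, and let $\rho=\rho(T)$. Then $\theta=2\rho$. Let $t=t(n)$ be a sequence of non-negative integers, and let $\Gamma_t$ be the trace of the random walk of length $t$ on the complete graph $K_n$. Then $$\lim_{n\to\infty}\mathbb{P}(T\subseteq\Gamma_t)=\begin{cases}0 & \text{if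 } t\ll n^{1-2/\theta},\\ 1 & \text{if } t\gg n^{1-2/\theta};\end{cases}$$ equivalently, $$\lim_{n\to\infty}\mathbb{P}(T\subseteq\Gamma_t)=\begin{cases}0 & \text{if } t\ll n^{1-1/\rho},\\ 1 & \text{if } t\gg n^{1-1/\rho}.\end{cases}$$ In particular, for every fixed path $P$, if $t\gg1$ (that is, $t\to\infty$), then $\mathbb{P}(P\subseteq\Gamma_t)\to1$. -/

import Mathlib

open Filter Topology
open scoped SimpleGraph

namespace TraceOfWalk

/-- The closed neighbourhood of `v` in `G`, that is `{v} ∪ N(v)`. -/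
noncomputable def closedNbhd {V : Type*} [Fintype V] (G : SimpleGraph V) (v : V) : Finset V :=
  open Classical in Finset.univ.filter fun w => w = v ∨ G.Adj v w

theorem closedNbhd_nonempty {V : Type*} [Fintype V] (G : SimpleGraph V) (v : V) :
    (closedNbhd G v).Nonempty :=
  ⟨v, by simp [closedNbhd]⟩

/-- The law of the initial segment `(X 0, …, X t)` of the (lazy) simple random walk on `G`:
`X 0` is uniform on the vertex set and, given the past, `X (t + 1)` is uniform on the closed
neighbourhood of `X t`. -/
noncomputable def walkLaw {V : Type*} [Fintype V] [Nonempty V] (G : SimpleGraph V) :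
    (t : ℕ) → PMF (Fin (t + 1) → V)
  | 0 => (PMF.uniformOfFintype V).map fun v _ => v
  | t + 1 => (walkLaw G t).bind fun x =>
      (PMF.uniformOfFinset (closedNbhd G (x (Fin.last t)))
        (closedNbhd_nonempty G (x (Fin.last t)))).map fun v => Fin.snoc x v

/-- The trace of a trajectory `x 0, …, x t`: the simple graph on the whole vertex set whose edges
are the pairs `{x s, x (s + 1)}` with `s < t` and `x s ≠ x (s + 1)`
(`SimpleGraph.fromEdgeSet` discards the loops). -/
def trace {V : Type*} {t : ℕ} (x : Fin (t + 1) → V) : SimpleGraph V :=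
  SimpleGraph.fromEdgeSet {e | ∃ s : Fin t, e = s(x s.castSucc, x s.succ)}

/-- The law of the random graph `Γ_t`, the trace of the random walk of length `t` on `G`. -/
noncomputable def traceLaw {V : Type*} [Fintype V] [Nonempty V] (G : SimpleGraph V) (t : ℕ) :
    PMF (SimpleGraph V) :=
  (walkLaw G t).map trace

/-- The probability that the trace of the random walk of length `t` on the complete graph on
`n ≥ 1` vertices contains a (not necessarily induced) copy of `H`. -/
noncomputable def containProb {W : Type*} (H : SimpleGraph W) (n : ℕ+) (t : ℕ) : ℝ :=
  ((traceLaw (⊤ : SimpleGraph (Fin n)) t).toOuterMeasure {Γ | H ⊑ Γ}).toReal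

/-- The number of vertices of odd degree. -/
noncomputable def oddCount {V : Type*} [Fintype V] (G : SimpleGraph V) : ℕ :=
  open Classical in (Finset.univ.filter fun v => Odd (G.degree v)).card

/-- The edge set of `G` is the union of the edge sets of `r` pairwise edge-disjoint trails. -/
def HasTrailDecomposition {V : Type*} (G : SimpleGraph V) (r : ℕ) : Prop :=
  ∃ (a b : Fin r → V) (p : ∀ i, G.Walk (a i) (b i)),
    (∀ i, (p i).IsTrail) ∧
    (∀ i j, i ≠ j → List.Disjoint (p i).edges (p j).edges) ∧
    ∀ e ∈ G.edgeSet, ∃ i, e ∈ (p i).edges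

/-- The trail decomposition number of a finite graph. -/
noncomputable def trailNumber {V : Type*} (G : SimpleGraph V) : ℕ :=
  sInf {r | HasTrailDecomposition G r}

/-- `f ≪ g`, for positive `g`. -/
def MuchLess (f g : ℕ+ → ℝ) : Prop := Tendsto (fun n => f n / g n) atTop (𝓝 0)

/-- `f ≫ g`, for positive `g`. -/
def MuchGreater (f g : ℕ+ → ℝ) : Prop := Tendsto (fun n => f n / g n) atTop atTop

end TraceOfWalk

/-! A trail meets a vertex in an odd number of edges only if the vertex is one of its two distinct
ends, so `ρ` trails account for at most `2ρ` odd vertices. In a forest equality holds: removing the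
edges of a longest path takes exactly its two end leaves out of the set of odd vertices, and one
inducts (`oddCount_eq_two_mul_trailNumber`).

On `K_n` every closed neighbourhood is the whole vertex set, so the trajectory is a uniform word of
length `t + 1` over `n` letters and all probabilities become counts of words.

Below the threshold a union bound suffices (`containProb_le`). A copy of a tree with `e` edges
selects `e` distinct steps; if they form `r` runs, they involve `e + r` positions. There are
`O(t^r)` families of steps and `n^(e+1)` placements of the vertices, giving `O(t^r n^(1-r))`. Odd
vertices occur only at ends of runs, hence `r ≥ ρ`.

Above the threshold a second moment argument is used (`card_le_of_forall_notMem_occurrences`). Time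
is cut into `ρ` series of `m ≍ t` blocks, and one counts the ways to spell the `i`-th trail in a
block of the `i`-th series. Two choices of blocks sharing exactly the series in `I ≠ ∅` are
correlated, but acyclicity bounds their relative contribution by `O((n/m)^|I| / n)`, which vanishes
since `|I| ≤ ρ`. -/

namespace TraceOfWalk

/-! ### Odd vertices and trail decompositions of forests. -/

section TrailDecomposition

open Classical SimpleGraph

variable {V : Type*} {G : SimpleGraph V}

theorem card_filter_mem_edges {a b : V} {p : G.Walk a b} (hp : p.IsTrail) (v : V) :
    (p.edges.toFinset.filter fun e => v ∈ e).card = p.edges.countP fun e => v ∈ e := by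
  have h : (p.edges.toFinset.filter fun e => v ∈ e) =
      (p.edges.filter fun e => decide (v ∈ e)).toFinset := by
    ext e
    simp
  rw [h, List.toFinset_card_of_nodup (hp.edges_nodup.filter _), List.countP_eq_length_filter]

/-- A vertex incident with an odd number of edges of a trail is one of its two distinct ends. -/
theorem odd_countP_edges_iff {a b : V} {p : G.Walk a b} (hp : p.IsTrail) (v : V) :
    Odd (p.edges.countP fun e => v ∈ e) ↔ a ≠ b ∧ (v = a ∨ v = b) := by
  rw [← Nat.not_even_iff_odd, hp.even_countP_edges_iff]
  tauto

theorem HasTrailDecomposition.succ_of_deleteEdges {a b : V} {p : G.Walk a b} (hp : p.IsTrail)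
    {r : ℕ} (h : HasTrailDecomposition (G.deleteEdges {e | e ∈ p.edges}) r) :
    HasTrailDecomposition G (r + 1) := by
  obtain ⟨a', b', q, hq, hd, hc⟩ := h
  have hle : G.deleteEdges {e | e ∈ p.edges} ≤ G := deleteEdges_le _
  have hnot : ∀ i e, e ∈ (q i).edges → e ∉ p.edges := by
    intro i e he
    have := (q i).edges_subset_edgeSet he
    rw [edgeSet_deleteEdges] at this
    exact this.2
  refine ⟨Fin.cons a a', Fin.cons b b',
    Fin.cons (α := fun i => G.Walk (Fin.cons (α := fun _ => V) a a' i)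
      (Fin.cons (α := fun _ => V) b b' i)) p fun i => (q i).mapLe hle, ?_, ?_, ?_⟩
  · intro i
    refine Fin.cases ?_ (fun i => ?_) i
    · exact hp
    · exact Walk.IsTrail.mapLe hle (hq i)
  · intro i j
    refine Fin.cases ?_ (fun i => ?_) i <;> refine Fin.cases ?_ (fun j => ?_) j
    · exact fun h => absurd rfl h
    · intro _
      change List.Disjoint p.edges ((q j).mapLe hle).edges
      rw [Walk.edges_mapLe_eq_edges]
      exact fun e he he' => hnot _ _ he' he
    · intro _
      change List.Disjoint ((q i).mapLe hle).edges p.edges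
      rw [Walk.edges_mapLe_eq_edges]
      exact hnot _
    · intro hij
      change List.Disjoint ((q i).mapLe hle).edges ((q j).mapLe hle).edges
      rw [Walk.edges_mapLe_eq_edges, Walk.edges_mapLe_eq_edges]
      exact hd i j (by rintro rfl; exact hij rfl)
  · intro e he
    by_cases hep : e ∈ p.edges
    · exact ⟨0, hep⟩
    · obtain ⟨i, hi⟩ := hc e (by rw [edgeSet_deleteEdges]; exact ⟨he, hep⟩)
      refine ⟨i.succ, ?_⟩
      change e ∈ ((q i).mapLe hle).edges
      rwa [Walk.edges_mapLe_eq_edges]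

variable [Fintype V]

theorem degree_eq_sum_countP_edges {r : ℕ} {a b : Fin r → V} {p : ∀ i, G.Walk (a i) (b i)}
    (hp : ∀ i, (p i).IsTrail) (hd : ∀ i j, i ≠ j → List.Disjoint (p i).edges (p j).edges)
    (hc : ∀ e ∈ G.edgeSet, ∃ i, e ∈ (p i).edges) (v : V) :
    G.degree v = ∑ i, (p i).edges.countP fun e => v ∈ e := by
  have h : G.incidenceFinset v =
      Finset.univ.biUnion fun i => (p i).edges.toFinset.filter fun e => v ∈ e := by
    ext e
    simp only [mem_incidenceFinset, incidenceSet, Set.mem_ofPred_eq, Finset.mem_biUnion,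
      Finset.mem_univ, true_and, Finset.mem_filter, List.mem_toFinset]
    constructor
    · rintro ⟨he, hv⟩
      obtain ⟨i, hi⟩ := hc e he
      exact ⟨i, hi, hv⟩
    · rintro ⟨i, hi, hv⟩
      exact ⟨(p i).edges_subset_edgeSet hi, hv⟩
  rw [← card_incidenceFinset_eq_degree, h, Finset.card_biUnion]
  · exact Finset.sum_congr rfl fun i _ => card_filter_mem_edges (hp i) v
  · intro i _ j _ hij
    refine Finset.disjoint_left.2 fun e he he' => ?_
    simp only [Finset.mem_filter, List.mem_toFinset] at he he'
    exact hd i j hij he.1 he'.1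

/-- The degree is the sum of the contributions of the trails, so at an odd vertex some trail
contributes an odd number and therefore ends there. -/
theorem oddCount_le_of_hasTrailDecomposition {r : ℕ} (h : HasTrailDecomposition G r) :
    oddCount G ≤ 2 * r := by
  obtain ⟨a, b, p, hp, hd, hc⟩ := h
  have hsub : (Finset.univ.filter fun v => Odd (G.degree v)) ⊆
      Finset.univ.image a ∪ Finset.univ.image b := by
    intro v hv
    simp only [Finset.mem_filter, Finset.mem_univ, true_and] at hv
    rw [degree_eq_sum_countP_edges hp hd hc v] at hv
    obtain ⟨i, -, hi⟩ : ∃ i ∈ Finset.univ, Odd ((p i).edges.countP fun e => v ∈ e) := by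
      by_contra! hcon
      refine (Nat.not_even_iff_odd.2 hv) (Finset.even_sum _ fun i hi => ?_)
      exact Nat.not_odd_iff_even.1 (hcon i hi)
    rcases ((odd_countP_edges_iff (hp i) v).1 hi).2 with rfl | rfl <;> simp
  calc oddCount G ≤ _ := by
        unfold oddCount
        exact Finset.card_le_card hsub
    _ ≤ _ := Finset.card_union_le _ _
    _ ≤ Fintype.card (Fin r) + Fintype.card (Fin r) :=
        Nat.add_le_add Finset.card_image_le Finset.card_image_le
    _ = 2 * r := by simp [two_mul]

/-- The ends of a longest path are leaves: another neighbour of an end would either prolong the path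
or close a cycle. -/
theorem exists_isPath_between_leaves (hG : G.IsAcyclic) (hne : G ≠ ⊥) :
    ∃ (u v : V) (p : G.Walk u v), p.IsPath ∧ u ≠ v ∧ G.degree u = 1 ∧ G.degree v = 1 := by
  obtain ⟨x, y, hxy⟩ := ne_bot_iff_exists_adj.1 hne
  have : Nonempty V := ⟨x⟩
  obtain ⟨u, v, p, hp, hmax⟩ := Walk.exists_isPath_forall_isPath_length_le_length G
  have hnil : ¬p.Nil := by
    intro h
    have h1 := hmax _ _ hxy.toWalk (by simp [hxy.ne])
    rw [Walk.length_eq_zero_iff.2 h] at h1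
    simp at h1
  refine ⟨u, v, p, hp, hp.nil_iff_eq.not.mp hnil, ?_, ?_⟩ <;>
    rw [degree_eq_one_iff_existsUnique_adj]
  · refine ⟨_, p.adj_snd hnil, fun w hadj ↦ ?_⟩
    apply hG.eq_snd_of_adj_start hp hadj
    have : ¬(p.cons hadj.symm).IsPath := by grind [Walk.length_cons]
    grind [hp.cons]
  · refine ⟨_, p.adj_penultimate hnil |>.symm, fun w hadj ↦ ?_⟩
    apply hG.eq_penultimate_of_adj_end hp hadj
    have : ¬(p.concat hadj).IsPath := by grind [Walk.length_concat]
    grind [hp.concat]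

theorem degree_eq_degree_add_countP_edges {G' : SimpleGraph V} {a b : V} {p : G.Walk a b}
    (hp : p.IsTrail) (hG' : G'.edgeSet = G.edgeSet \ {e | e ∈ p.edges}) (v : V) :
    G.degree v = G'.degree v + p.edges.countP fun e => v ∈ e := by
  have h : G.incidenceFinset v = G'.incidenceFinset v ∪
      p.edges.toFinset.filter fun e => v ∈ e := by
    ext e
    have := @Walk.edges_subset_edgeSet _ G _ _ p e
    simp only [mem_incidenceFinset, incidenceSet, Set.mem_ofPred_eq, Finset.mem_union,
      Finset.mem_filter, List.mem_toFinset, hG', Set.mem_sdiff]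
    tauto
  rw [← card_incidenceFinset_eq_degree, h, Finset.card_union_of_disjoint,
    card_incidenceFinset_eq_degree, card_filter_mem_edges hp]
  rw [Finset.disjoint_left]
  intro e he he'
  simp only [mem_incidenceFinset, incidenceSet, Set.mem_ofPred_eq, hG', Set.mem_sdiff] at he
  simp only [Finset.mem_filter, List.mem_toFinset] at he'
  exact he.1.2 he'.1

/-- Induction on the number of edges: a leaf-to-leaf path is split off as one trail. Its ends become
isolated and every other parity is kept, so the number of odd vertices drops by exactly two. -/
theorem exists_hasTrailDecomposition_oddCount_eq (hG : G.IsAcyclic) :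
    ∃ r, HasTrailDecomposition G r ∧ oddCount G = 2 * r := by
  induction hm : G.edgeFinset.card using Nat.strong_induction_on generalizing G with
  | _ m ih =>
  by_cases hbot : G = ⊥
  · subst hbot
    refine ⟨0, ⟨Fin.elim0, Fin.elim0, fun i => i.elim0, fun i => i.elim0, fun i => i.elim0, ?_⟩,
      ?_⟩
    · simp
    · simp [oddCount]
  · obtain ⟨u, v, p, hp, huv, hu, hv⟩ := exists_isPath_between_leaves hG hbot
    obtain ⟨G', hG'⟩ : ∃ G', G' = G.deleteEdges {e | e ∈ p.edges} := ⟨_, rfl⟩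
    have hle : G' ≤ G := hG' ▸ deleteEdges_le _
    have hdeg := fun w => degree_eq_degree_add_countP_edges hp.isTrail
      (hG' ▸ edgeSet_deleteEdges _) w
    have hodd := fun w => odd_countP_edges_iff hp.isTrail w
    have hlt : G'.edgeFinset.card < m := by
      have hss : G' < G := by
        refine lt_of_le_of_ne hle fun heq => ?_
        have h1 := hdeg u
        have h2 : Odd (p.edges.countP fun e => u ∈ e) := (hodd u).2 ⟨huv, Or.inl rfl⟩
        have := h2.pos
        rw [heq] at h1
        omega
      rw [← hm]
      exact Finset.card_lt_card (edgeFinset_ssubset_edgeFinset.2 hss)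
    obtain ⟨r, hr, hodd'⟩ := ih _ hlt (hG.anti hle) (by congr)
    refine ⟨r + 1, HasTrailDecomposition.succ_of_deleteEdges hp.isTrail (hG' ▸ hr), ?_⟩
    have hset : (Finset.univ.filter fun w => Odd (G.degree w)) =
        insert u (insert v (Finset.univ.filter fun w => Odd (G'.degree w))) := by
      ext w
      simp only [Finset.mem_filter, Finset.mem_univ, true_and, Finset.mem_insert]
      by_cases hwu : w = u
      · subst hwu; simp [hu]
      by_cases hwv : w = v
      · subst hwv; simp [hv]
      have h1 : Even (p.edges.countP fun e => w ∈ e) := by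
        rw [← Nat.not_odd_iff_even, hodd]
        tauto
      rw [hdeg w]
      simp only [hwu, hwv, false_or]
      rw [Nat.odd_add]
      tauto
    have hnot : ∀ w, G.degree w = 1 → (w = u ∨ w = v) → ¬ Odd (G'.degree w) := by
      intro w hw1 hw2
      have h2 : Odd (p.edges.countP fun e => w ∈ e) := (hodd w).2 ⟨huv, hw2⟩
      have h3 := hdeg w
      have := h2.pos
      have : G'.degree w = 0 := by omega
      simp [this]
    have hcard : oddCount G = oddCount G' + 2 := by
      unfold oddCount
      rw [hset, Finset.card_insert_of_notMem, Finset.card_insert_of_notMem]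
      · simpa using hnot v hv (Or.inr rfl)
      · simpa [huv] using hnot u hu (Or.inl rfl)
    rw [hcard, hodd']
    ring

theorem oddCount_eq_two_mul_trailNumber (hG : G.IsAcyclic) :
    oddCount G = 2 * trailNumber G := by
  obtain ⟨r, hr, hodd⟩ := exists_hasTrailDecomposition_oddCount_eq hG
  have h1 : trailNumber G ≤ r := Nat.sInf_le hr
  have h2 := oddCount_le_of_hasTrailDecomposition
    (Nat.sInf_mem (s := {r | HasTrailDecomposition G r}) ⟨r, hr⟩)
  change oddCount G ≤ 2 * trailNumber G at h2
  omega

theorem hasTrailDecomposition_trailNumber (hG : G.IsAcyclic) :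
    HasTrailDecomposition G (trailNumber G) := by
  obtain ⟨r, hr, -⟩ := exists_hasTrailDecomposition_oddCount_eq hG
  exact Nat.sInf_mem (s := {r | HasTrailDecomposition G r}) ⟨r, hr⟩

theorem IsAcyclic.card_edgeFinset_lt [Nonempty V] (hG : G.IsAcyclic) :
    G.edgeFinset.card + 1 ≤ Fintype.card V := by
  obtain ⟨F, hF, -, hT⟩ := (connected_top (V := V)).exists_isTree_le_of_le_of_isAcyclic le_top hG
  rw [← hT.card_edgeFinset]
  exact Nat.add_le_add_right (Finset.card_le_card (edgeFinset_subset_edgeFinset.2 hF)) 1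

end TrailDecomposition

/-! ### The walk on the complete graph as a uniform random word. -/

section UniformWords

open Classical

theorem closedNbhd_top {V : Type*} [Fintype V] (v : V) :
    closedNbhd (⊤ : SimpleGraph V) v = Finset.univ := by
  ext w
  simp only [closedNbhd, Finset.mem_filter, Finset.mem_univ, true_and, SimpleGraph.top_adj]
  tauto

/-- On the complete graph all trajectories are equally likely. -/
theorem walkLaw_top_apply {V : Type*} [Fintype V] [Nonempty V] (t : ℕ) (x : Fin (t + 1) → V) :
    walkLaw (⊤ : SimpleGraph V) t x = ((Fintype.card V : ENNReal) ^ (t + 1))⁻¹ := by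
  have hc : (Fintype.card V : ENNReal) ≠ 0 := by simp
  have ht : (Fintype.card V : ENNReal) ≠ ⊤ := by simp
  induction t with
  | zero =>
    rw [walkLaw, PMF.map_apply, tsum_eq_single (x 0)]
    · rw [if_pos]
      · simp
      · funext i
        rw [show i = 0 from Fin.ext (by omega)]
    · intro v hv
      rw [if_neg]
      intro h
      exact hv (by rw [h])
  | succ t ih =>
    rw [walkLaw, PMF.bind_apply, tsum_eq_single (Fin.init x)]
    · rw [ih, PMF.map_apply, tsum_eq_single (x (Fin.last _))]
      · rw [if_pos (by simp), PMF.uniformOfFinset_apply, closedNbhd_top]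
        rw [if_pos (Finset.mem_univ _), Finset.card_univ, pow_succ (n := t + 1),
          ENNReal.mul_inv (Or.inr ht) (Or.inr hc)]
      · intro v hv
        rw [if_neg]
        intro h
        exact hv (by rw [h]; simp)
    · intro y hy
      rw [PMF.map_apply, ENNReal.tsum_eq_zero.2, mul_zero]
      intro v
      rw [if_neg]
      intro h
      exact hy (by rw [h]; simp)

theorem containProb_eq {W : Type*} (H : SimpleGraph W) (n : ℕ+) (t : ℕ) :
    containProb H n t =
      ((Finset.univ.filter fun x : Fin (t + 1) → Fin n => H ⊑ trace x).card : ℝ) /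
        ((n : ℕ) : ℝ) ^ (t + 1) := by
  rw [containProb, traceLaw, PMF.toOuterMeasure_map_apply, PMF.toOuterMeasure_apply_fintype]
  simp only [Set.indicator_apply, walkLaw_top_apply, Set.mem_preimage, Set.mem_ofPred_eq,
    Fintype.card_fin]
  rw [← Finset.sum_filter, Finset.sum_const, nsmul_eq_mul, ENNReal.toReal_mul,
    ENNReal.toReal_inv, div_eq_mul_inv]
  simp

/-- The number of words over `α` with prescribed letters at the positions in `U`. -/
theorem card_filter_forall_mem_eq_mul {κ α : Type*} [Fintype κ] [Fintype α] (U : Finset κ)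
    (g : κ → α) :
    (Finset.univ.filter fun x : κ → α => ∀ u ∈ U, x u = g u).card * Fintype.card α ^ U.card =
      Fintype.card α ^ Fintype.card κ := by
  have h : (Finset.univ.filter fun x : κ → α => ∀ u ∈ U, x u = g u) =
      Fintype.piFinset fun i => if i ∈ U then {g i} else Finset.univ := by
    ext x
    simp only [Finset.mem_filter, Finset.mem_univ, true_and, Fintype.mem_piFinset]
    refine forall_congr' fun i => ?_
    by_cases hi : i ∈ U <;> simp [hi]
  rw [h, Fintype.card_piFinset]
  have h2 : ∀ i, (if i ∈ U then ({g i} : Finset α) else Finset.univ).card =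
      if i ∈ U then 1 else Fintype.card α := by
    intro i
    split_ifs <;> simp
  simp only [h2]
  rw [← Finset.prod_const, ← Finset.prod_filter_mul_prod_filter_not Finset.univ (· ∈ U),
    ← Finset.card_univ (α := κ), ← Finset.prod_const,
    ← Finset.prod_filter_mul_prod_filter_not (Finset.univ : Finset κ) (· ∈ U)]
  rw [Finset.prod_congr (g := fun _ => 1) rfl, Finset.prod_const_one, one_mul, mul_comm]
  · congr 1
    · exact Finset.prod_congr (by ext; simp) fun _ _ => rfl
    · refine Finset.prod_congr rfl fun i hi => ?_
      rw [if_neg (Finset.mem_filter.1 hi).2]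
  · intro i hi
    rw [if_pos (Finset.mem_filter.1 hi).2]

theorem card_filter_forall_mem_eq {κ α : Type*} [Fintype κ] [Fintype α] [Nonempty α]
    (U : Finset κ) (g : κ → α) :
    ((Finset.univ.filter fun x : κ → α => ∀ u ∈ U, x u = g u).card : ℝ) =
      (Fintype.card α : ℝ) ^ Fintype.card κ / (Fintype.card α : ℝ) ^ U.card := by
  rw [eq_div_iff (by positivity)]
  exact_mod_cast card_filter_forall_mem_eq_mul U g

/-- A set of words that agree at the positions in `U` is small. -/
theorem card_le_of_forall_mem_eq {κ α : Type*} [Fintype κ] [Fintype α] [Nonempty α]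
    (U : Finset κ) (A : Finset (κ → α)) (h : ∀ x ∈ A, ∀ y ∈ A, ∀ u ∈ U, x u = y u) :
    (A.card : ℝ) ≤ (Fintype.card α : ℝ) ^ Fintype.card κ / (Fintype.card α : ℝ) ^ U.card := by
  rcases A.eq_empty_or_nonempty with rfl | ⟨y, hy⟩
  · simp only [Finset.card_empty, Nat.cast_zero]
    positivity
  · rw [← card_filter_forall_mem_eq U y, Nat.cast_le]
    exact Finset.card_le_card fun x hx => by simpa using h x hx y hy

theorem trace_adj {V : Type*} {t : ℕ} {x : Fin (t + 1) → V} {u v : V} :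
    (trace x).Adj u v ↔ (∃ s : Fin t, s(u, v) = s(x s.castSucc, x s.succ)) ∧ u ≠ v := by
  rw [trace, SimpleGraph.fromEdgeSet_adj, Set.mem_ofPred_eq]

end UniformWords

/-! ### First moment: no copy below the threshold. -/

section FirstMoment

open Classical SimpleGraph

theorem exists_mem_run_start (S : Finset ℕ) {u : ℕ} (hu : u ∈ S) :
    ∃ v ∈ S, (∀ w, w + 1 = v → w ∉ S) ∧ v ≤ u ∧ u < v + S.card := by
  obtain ⟨v, hv, hvS, hvmin⟩ : ∃ v ≤ u, (∀ w, v ≤ w → w ≤ u → w ∈ S) ∧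
      ∀ w, w + 1 = v → w ∉ S := by
    -- The least `v` for which the whole interval from `v` to `u` lies in `S` begins the run of `u`.
    have hex : ∃ v, v ≤ u ∧ ∀ w, v ≤ w → w ≤ u → w ∈ S :=
      ⟨u, le_rfl, fun w h1 h2 => by rwa [le_antisymm h2 h1]⟩
    refine ⟨Nat.find hex, (Nat.find_spec hex).1, (Nat.find_spec hex).2, fun w hw hwS => ?_⟩
    refine Nat.find_min hex (m := w) (by omega) ⟨?_, fun z hz hzu => ?_⟩
    · have := (Nat.find_spec hex).1
      omega
    · rcases hz.eq_or_lt with rfl | hlt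
      · exact hwS
      · exact (Nat.find_spec hex).2 z (by omega) hzu
  refine ⟨v, hvS v le_rfl hv, hvmin, hv, ?_⟩
  have h : Finset.Icc v u ⊆ S := fun w hw => by
    rw [Finset.mem_Icc] at hw
    exact hvS w hw.1 hw.2
  have := Finset.card_le_card h
  rw [Nat.card_Icc] at this
  omega

variable {ι : Type*} [Fintype ι] {t : ℕ}

/-- The starting points of the steps indexed by `s`. -/
noncomputable def stepStarts (s : ι → Fin t) : Finset (Fin (t + 1)) :=
  Finset.univ.image fun e => (s e).castSucc

/-- The end points of the steps indexed by `s`. -/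
noncomputable def stepEnds (s : ι → Fin t) : Finset (Fin (t + 1)) :=
  Finset.univ.image fun e => (s e).succ

/-- The number of maximal runs of consecutive steps. -/
noncomputable def runCount (s : ι → Fin t) : ℕ :=
  (stepStarts s \ stepEnds s).card

theorem card_stepStarts {s : ι → Fin t} (hs : Function.Injective s) :
    (stepStarts s).card = Fintype.card ι :=
  Finset.card_image_of_injective _ ((Fin.castSucc_injective t).comp hs)

theorem card_stepEnds {s : ι → Fin t} (hs : Function.Injective s) :
    (stepEnds s).card = Fintype.card ι :=
  Finset.card_image_of_injective _ ((Fin.succ_injective t).comp hs)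

theorem card_stepEnds_sdiff {s : ι → Fin t} (hs : Function.Injective s) :
    (stepEnds s \ stepStarts s).card = runCount s :=
  Finset.card_sdiff_comm ((card_stepEnds hs).trans (card_stepStarts hs).symm)

/-- A run of `k` steps involves `k + 1` positions, so each run adds one to the number of steps. -/
theorem card_stepStarts_union_stepEnds {s : ι → Fin t} (hs : Function.Injective s) :
    (stepStarts s ∪ stepEnds s).card = Fintype.card ι + runCount s := by
  rw [← Finset.sdiff_union_self_eq_union, Finset.card_union_of_disjoint Finset.sdiff_disjoint,
    card_stepEnds hs, runCount, add_comm]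

theorem runCount_le (s : ι → Fin t) (hs : Function.Injective s) :
    runCount s ≤ Fintype.card ι :=
  (Finset.card_le_card Finset.sdiff_subset).trans (card_stepStarts hs).le

/-- Families of steps that form `r` runs are determined by the first steps of the runs, up to
boundedly many choices. -/
theorem card_filter_runCount_eq_le (ι : Type*) [Fintype ι] (t r : ℕ) :
    (Finset.univ.filter fun s : ι → Fin t => Function.Injective s ∧ runCount s = r).card ≤
      t ^ r * (r * Fintype.card ι) ^ Fintype.card ι := by
  -- Each step is encoded by the index of its run and its offset from the first step of that run;
  -- the offset is less than the number of steps.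
  have key : ∀ s : {s : ι → Fin t // Function.Injective s ∧ runCount s = r},
      ∃ F : (Fin r → Fin t) × (ι → Fin r × Fin (Fintype.card ι)),
        ∀ e, (s.1 e : ℕ) = F.1 (F.2 e).1 + (F.2 e).2 := by
    rintro ⟨s, hs, hr⟩
    have hcard : Fintype.card {u // u ∈ stepStarts s \ stepEnds s} = r := by
      rw [Fintype.card_coe]
      exact hr
    let E := Fintype.equivFinOfCardEq hcard
    have hlt : ∀ u : {u // u ∈ stepStarts s \ stepEnds s}, ((u : Fin (t + 1)) : ℕ) < t := by
      rintro ⟨u, hu⟩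
      rw [Finset.mem_sdiff, stepStarts, Finset.mem_image] at hu
      obtain ⟨⟨e, -, rfl⟩, -⟩ := hu
      exact (s e).2
    have h2 : ∀ e, ∃ (k : Fin r × Fin (Fintype.card ι)),
        (s e : ℕ) = ((E.symm k.1 : Fin (t + 1)) : ℕ) + k.2 := by
      intro e
      set S : Finset ℕ := Finset.univ.image fun e => (s e : ℕ) with hS
      have hSc : S.card = Fintype.card ι :=
        Finset.card_image_of_injective _ (Fin.val_injective.comp hs)
      obtain ⟨v, hv, hvmin, hvu, huv⟩ := exists_mem_run_start S (u := s e)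
        (Finset.mem_image_of_mem _ (Finset.mem_univ _))
      rw [hS, Finset.mem_image] at hv
      obtain ⟨e', -, rfl⟩ := hv
      have hmem : (s e').castSucc ∈ stepStarts s \ stepEnds s := by
        rw [Finset.mem_sdiff]
        refine ⟨Finset.mem_image_of_mem _ (Finset.mem_univ _), fun hmem => ?_⟩
        rw [stepEnds, Finset.mem_image] at hmem
        obtain ⟨e'', -, he''⟩ := hmem
        refine hvmin (s e'') ?_ (Finset.mem_image_of_mem _ (Finset.mem_univ _))
        simpa [Fin.ext_iff] using he''
      refine ⟨(E ⟨_, hmem⟩, ⟨s e - s e', by omega⟩), ?_⟩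
      simp only [Equiv.symm_apply_apply, Fin.val_castSucc]
      omega
    choose k hk using h2
    exact ⟨(fun i => ⟨_, hlt (E.symm i)⟩, k), hk⟩
  choose F hF using key
  have hinj : Function.Injective F := fun s s' hss => by
    apply Subtype.ext
    funext e
    apply Fin.ext
    rw [hF s e, hF s' e, hss]
  calc _ = Fintype.card {s : ι → Fin t // Function.Injective s ∧ runCount s = r} :=
        (Fintype.card_subtype _).symm
    _ ≤ _ := Fintype.card_le_of_injective F hinj
    _ = _ := by simp

variable {V : Type*} {T : SimpleGraph V}

/-- Each edge of the copy is assigned a step traversing it, and `o` records the direction. A step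
determines the edge it traverses, so different edges receive different steps. -/
theorem exists_steps_of_isContained_trace {α : Type*} {x : Fin (t + 1) → α} (h : T ⊑ trace x) :
    ∃ (s : T.edgeSet → Fin t) (o : T.edgeSet → V × V) (φ : V → α), Function.Injective s ∧
      (∀ e, s((o e).1, (o e).2) = e) ∧ Function.Injective φ ∧
      (∀ e, x (s e).castSucc = φ (o e).1) ∧ ∀ e, x (s e).succ = φ (o e).2 := by
  obtain ⟨f⟩ := h
  have key : ∀ e : T.edgeSet, ∃ (u : Fin t) (p : V × V), s(p.1, p.2) = (e : Sym2 V) ∧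
      x u.castSucc = f p.1 ∧ x u.succ = f p.2 := by
    rintro ⟨e, he⟩
    induction e with
    | _ a b =>
      obtain ⟨⟨u, hu⟩, -⟩ := trace_adj.1 (f.toHom.map_adj he)
      rw [Sym2.eq_iff] at hu
      rcases hu with ⟨ha, hb⟩ | ⟨ha, hb⟩
      · exact ⟨u, (a, b), rfl, ha.symm, hb.symm⟩
      · exact ⟨u, (b, a), Sym2.eq_swap, hb.symm, ha.symm⟩
  choose s o ho h1 h2 using key
  refine ⟨s, o, f, ?_, ho, f.injective, h1, h2⟩
  intro e e' hee
  have ha : f (o e).1 = f (o e').1 := by rw [← h1, ← h1, hee]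
  have hb : f (o e).2 = f (o e').2 := by rw [← h2, ← h2, hee]
  apply Subtype.ext
  rw [← ho, ← ho, f.injective ha, f.injective hb]

variable [Fintype V]

theorem degree_eq_card_add_card (o : T.edgeSet → V × V) (ho : ∀ e, s((o e).1, (o e).2) = e)
    (v : V) :
    T.degree v = (Finset.univ.filter fun e => (o e).1 = v).card +
      (Finset.univ.filter fun e => (o e).2 = v).card := by
  rw [← card_incidenceFinset_eq_degree, ← Finset.card_union_of_disjoint]
  · symm
    refine Finset.card_bij (fun e _ => (e : Sym2 V)) ?_ (fun _ _ _ _ h => Subtype.ext h) ?_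
    · intro e he
      rw [mem_incidenceFinset]
      refine ⟨e.2, ?_⟩
      rw [← ho e, Sym2.mem_iff]
      simp only [Finset.mem_union, Finset.mem_filter, Finset.mem_univ, true_and] at he
      rcases he with h | h
      · exact Or.inl h.symm
      · exact Or.inr h.symm
    · intro e he
      rw [mem_incidenceFinset] at he
      refine ⟨⟨e, he.1⟩, ?_, rfl⟩
      have h2 : v ∈ s((o ⟨e, he.1⟩).1, (o ⟨e, he.1⟩).2) := by
        rw [ho]
        exact he.2
      rw [Sym2.mem_iff] at h2
      simp only [Finset.mem_union, Finset.mem_filter, Finset.mem_univ, true_and]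
      rcases h2 with h | h
      · exact Or.inl h.symm
      · exact Or.inr h.symm
  · rw [Finset.disjoint_left]
    intro e he he'
    simp only [Finset.mem_filter, Finset.mem_univ, true_and] at he he'
    have h := e.2
    rw [← ho e, mem_edgeSet, he, he'] at h
    exact h.ne rfl

/-- Each vertex of odd degree is visited at the beginning or at the end of a run. -/
theorem oddCount_le_two_mul_runCount {α : Type*} {s : T.edgeSet → Fin t}
    (hs : Function.Injective s) {o : T.edgeSet → V × V} (ho : ∀ e, s((o e).1, (o e).2) = e)
    {x : Fin (t + 1) → α} {φ : V → α} (hφ : Function.Injective φ)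
    (h1 : ∀ e, x (s e).castSucc = φ (o e).1) (h2 : ∀ e, x (s e).succ = φ (o e).2) :
    oddCount T ≤ 2 * runCount s := by
  have hsub : (Finset.univ.filter fun v => Odd (T.degree v)).image φ ⊆
      ((stepStarts s \ stepEnds s) ∪ (stepEnds s \ stepStarts s)).image x := by
    intro y hy
    simp only [Finset.mem_image, Finset.mem_filter, Finset.mem_univ, true_and] at hy
    obtain ⟨v, hv, rfl⟩ := hy
    by_contra hcon
    simp only [Finset.mem_image, Finset.mem_union, Finset.mem_sdiff, not_exists] at hcon
    -- If `φ v` is never at an end of a run, every position at `φ v` that starts a chosen step also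
    -- ends one, and conversely. Then the in- and outdegree of `v` under `o` agree and its degree is
    -- even.
    have heq : (stepStarts s).filter (fun u => x u = φ v) =
        (stepEnds s).filter (fun u => x u = φ v) := by
      ext u
      have := hcon u
      simp only [Finset.mem_filter]
      tauto
    have hc1 : ((stepStarts s).filter (fun u => x u = φ v)).card =
        (Finset.univ.filter fun e => (o e).1 = v).card := by
      rw [stepStarts, Finset.filter_image,
        Finset.card_image_of_injective (f := fun e => (s e).castSucc) _
          ((Fin.castSucc_injective t).comp hs)]
      simp only [h1, hφ.eq_iff]
    have hc2 : ((stepEnds s).filter (fun u => x u = φ v)).card =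
        (Finset.univ.filter fun e => (o e).2 = v).card := by
      rw [stepEnds, Finset.filter_image,
        Finset.card_image_of_injective (f := fun e => (s e).succ) _
          ((Fin.succ_injective t).comp hs)]
      simp only [h2, hφ.eq_iff]
    rw [degree_eq_card_add_card o ho v, ← hc1, ← hc2, heq] at hv
    exact Nat.not_odd_iff_even.2 ⟨_, rfl⟩ hv
  have hle := Finset.card_le_card hsub
  rw [Finset.card_image_of_injective _ hφ] at hle
  calc oddCount T ≤ _ := by
        unfold oddCount
        exact hle
    _ ≤ _ := Finset.card_image_le
    _ ≤ _ := Finset.card_union_le _ _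
    _ = 2 * runCount s := by rw [card_stepEnds_sdiff hs, runCount, two_mul]

theorem containProb_le (T : SimpleGraph V) (hT : T.edgeFinset.card + 1 = Fintype.card V)
    {ρ : ℕ} (hρ : 2 * ρ ≤ oddCount T) (n : ℕ+) (t : ℕ) :
    containProb T n t ≤ ∑ r ∈ Finset.Icc ρ T.edgeFinset.card,
      (((r * T.edgeFinset.card) ^ T.edgeFinset.card *
        (Fintype.card V * Fintype.card V) ^ T.edgeFinset.card : ℕ) : ℝ) *
        ((t : ℝ) ^ r * n / (n : ℝ) ^ r) := by
  set E := T.edgeFinset.card with hE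
  have hEc : Fintype.card T.edgeSet = E := by rw [hE, edgeFinset_card]
  have hn : (0 : ℝ) < n := by exact_mod_cast n.pos
  let S := fun r => Finset.univ.filter fun s : T.edgeSet → Fin t =>
    Function.Injective s ∧ runCount s = r
  let A := fun (s : T.edgeSet → Fin t) (o : T.edgeSet → V × V) (φ : V → Fin n) =>
    Finset.univ.filter fun x : Fin (t + 1) → Fin n =>
      (∀ e, x (s e).castSucc = φ (o e).1) ∧ ∀ e, x (s e).succ = φ (o e).2
  -- Union bound over the number of runs, the steps, the orientations and the placement of the
  -- vertices.
  have hcover : (Finset.univ.filter fun x : Fin (t + 1) → Fin n => T ⊑ trace x) ⊆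
      (Finset.Icc ρ E).biUnion fun r => (S r).biUnion fun s =>
        Finset.univ.biUnion fun o : T.edgeSet → V × V =>
          Finset.univ.biUnion fun φ : V → Fin n => A s o φ := by
    intro x hx
    simp only [Finset.mem_filter, Finset.mem_univ, true_and] at hx
    obtain ⟨s, o, φ, hs, ho, hφ, h1, h2⟩ := exists_steps_of_isContained_trace hx
    have := oddCount_le_two_mul_runCount hs ho hφ h1 h2
    have h3 := runCount_le s hs
    rw [hEc] at h3
    simp only [Finset.mem_biUnion, Finset.mem_Icc, Finset.mem_univ, true_and]
    refine ⟨runCount s, ⟨by omega, h3⟩, s, by simp [S, hs], o, φ, by simp [A, h1, h2]⟩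
  have hA : ∀ r, ∀ s ∈ S r, ∀ o φ,
      ((A s o φ).card : ℝ) ≤ (n : ℝ) ^ (t + 1) / (n : ℝ) ^ (E + r) := by
    intro r s hs o φ
    simp only [S, Finset.mem_filter, Finset.mem_univ, true_and] at hs
    have := card_le_of_forall_mem_eq (stepStarts s ∪ stepEnds s) (A s o φ) ?_
    · rw [card_stepStarts_union_stepEnds hs.1, hs.2, hEc] at this
      simpa using this
    · intro x hx y hy u hu
      simp only [A, Finset.mem_filter, Finset.mem_univ, true_and] at hx hy
      rcases Finset.mem_union.1 hu with hu | hu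
      · obtain ⟨e, -, rfl⟩ := Finset.mem_image.1 hu
        rw [hx.1, hy.1]
      · obtain ⟨e, -, rfl⟩ := Finset.mem_image.1 hu
        rw [hx.2, hy.2]
  rw [containProb_eq, div_le_iff₀ (by positivity)]
  calc ((Finset.univ.filter fun x : Fin (t + 1) → Fin n => T ⊑ trace x).card : ℝ)
      ≤ ∑ r ∈ Finset.Icc ρ E, ∑ s ∈ S r, ∑ o : T.edgeSet → V × V, ∑ φ : V → Fin n,
          ((A s o φ).card : ℝ) := by
        have h := (Finset.card_le_card hcover).trans (Finset.card_biUnion_le.trans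
          (Finset.sum_le_sum fun r _ => Finset.card_biUnion_le.trans
            (Finset.sum_le_sum fun s _ => Finset.card_biUnion_le.trans
              (Finset.sum_le_sum fun o _ => Finset.card_biUnion_le))))
        exact_mod_cast h
    _ ≤ ∑ r ∈ Finset.Icc ρ E, ∑ s ∈ S r, ∑ o : T.edgeSet → V × V, ∑ φ : V → Fin n,
          (n : ℝ) ^ (t + 1) / (n : ℝ) ^ (E + r) :=
        Finset.sum_le_sum fun r _ => Finset.sum_le_sum fun s hs => Finset.sum_le_sum fun o _ =>
          Finset.sum_le_sum fun φ _ => hA r s hs o φ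
    -- Since a tree has `E + 1` vertices, the `n ^ (E + 1)` maps `φ` leave a single factor `n`
    -- against `n ^ E`.
    _ = ∑ r ∈ Finset.Icc ρ E, ((S r).card : ℝ) *
          (((Fintype.card V * Fintype.card V) ^ E : ℕ) : ℝ) *
            ((n : ℝ) / (n : ℝ) ^ r * (n : ℝ) ^ (t + 1)) := by
        refine Finset.sum_congr rfl fun r _ => ?_
        simp only [Finset.sum_const, Finset.card_univ, nsmul_eq_mul, Fintype.card_fun,
          Fintype.card_prod, Fintype.card_fin, hEc, ← hT]
        push_cast
        rw [pow_add _ E r, pow_succ _ E]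
        field_simp
    _ ≤ ∑ r ∈ Finset.Icc ρ E, (((t ^ r * (r * E) ^ E : ℕ)) : ℝ) *
          (((Fintype.card V * Fintype.card V) ^ E : ℕ) : ℝ) *
            ((n : ℝ) / (n : ℝ) ^ r * (n : ℝ) ^ (t + 1)) := by
        refine Finset.sum_le_sum fun r _ => ?_
        have hS : (S r).card ≤ t ^ r * (r * E) ^ E := by
          rw [← hEc]
          convert card_filter_runCount_eq_le T.edgeSet t r
        gcongr
    _ = _ := by
        rw [Finset.sum_mul]
        refine Finset.sum_congr rfl fun r _ => ?_
        push_cast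
        ring

end FirstMoment

/-! ### Second moment for patterns spelled in independently chosen blocks. -/

section SecondMoment

open Classical SimpleGraph

/-- Chebyshev's inequality in counting form: each zero of `N` contributes `μ ^ 2` to the sum of
squared deviations. -/
theorem card_filter_eq_zero_mul_sq_le {Ω : Type*} [Fintype Ω] (N : Ω → ℝ) (μ : ℝ)
    (h : ∑ x, N x = Fintype.card Ω * μ) :
    ((Finset.univ.filter fun x => N x = 0).card : ℝ) * μ ^ 2 ≤
      ∑ x, N x ^ 2 - Fintype.card Ω * μ ^ 2 := by
  calc ((Finset.univ.filter fun x => N x = 0).card : ℝ) * μ ^ 2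
      = ∑ x ∈ Finset.univ.filter fun x => N x = 0, (N x - μ) ^ 2 := by
        rw [Finset.sum_congr rfl (g := fun _ => μ ^ 2), Finset.sum_const, nsmul_eq_mul]
        intro x hx
        rw [(Finset.mem_filter.1 hx).2, zero_sub, neg_sq]
    _ ≤ ∑ x, (N x - μ) ^ 2 :=
        Finset.sum_le_sum_of_subset_of_nonneg (Finset.filter_subset _ _)
          fun _ _ _ => sq_nonneg _
    _ = ∑ x, (N x ^ 2 - 2 * μ * N x + μ ^ 2) := Finset.sum_congr rfl fun _ _ => by ring
    _ = _ := by
        rw [Finset.sum_add_distrib, Finset.sum_sub_distrib, ← Finset.mul_sum, h, Finset.sum_const,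
          Finset.card_univ, nsmul_eq_mul]
        ring

/-- The number of pairs of words that agree at all positions in `U`. -/
theorem sum_card_filter_forall_mem_eq {κ α : Type*} [Fintype κ] [Fintype α] [Nonempty α]
    (U : Finset κ) :
    ∑ g : κ → α, ((Finset.univ.filter fun x : κ → α => ∀ u ∈ U, x u = g u).card : ℝ) =
      (Fintype.card α : ℝ) ^ (2 * Fintype.card κ) / (Fintype.card α : ℝ) ^ U.card := by
  simp only [card_filter_forall_mem_eq, Finset.sum_const, Finset.card_univ, Fintype.card_fun,
    nsmul_eq_mul]
  push_cast
  rw [two_mul, pow_add, mul_div_assoc]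

variable {V D ι κ α : Type*} [Fintype D] [Fintype κ] [Fintype α]

/-- The words that spell the `φ`-image of the pattern `c` at the positions `q`. -/
noncomputable def occurrences (q : D → κ) (c : D → V) (φ : V → α) : Finset (κ → α) :=
  Finset.univ.filter fun x => ∀ d, x (q d) = φ (c d)

theorem card_occurrences [Nonempty α] {q : D → κ} (hq : Function.Injective q) (c : D → V)
    (φ : V → α) :
    ((occurrences q c φ).card : ℝ) =
      (Fintype.card α : ℝ) ^ Fintype.card κ / (Fintype.card α : ℝ) ^ Fintype.card D := by
  have h : occurrences q c φ = Finset.univ.filter fun x : κ → α =>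
      ∀ u ∈ Finset.univ.image q,
        x u = Function.extend q (φ ∘ c) (fun _ => Classical.arbitrary α) u := by
    ext x
    simp [occurrences, hq.extend_apply]
  rw [h, card_filter_forall_mem_eq, Finset.card_image_of_injective _ hq, Finset.card_univ]

/-- Together the two occurrences prescribe `2 * |D|` positions, less those shared; `hqq` makes a
shared position carry the same letter index in both. -/
theorem card_occurrences_inter_le [Nonempty α] {q q' : D → κ} (hq : Function.Injective q)
    (hq' : Function.Injective q') (hqq : ∀ d d', q d = q' d' → d = d') (c : D → V)
    (φ φ' : V → α) :
    ((occurrences q c φ ∩ occurrences q' c φ').card : ℝ) ≤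
      (Fintype.card α : ℝ) ^ Fintype.card κ *
        (Fintype.card α : ℝ) ^ (Finset.univ.filter fun d => q d = q' d).card /
          (Fintype.card α : ℝ) ^ (2 * Fintype.card D) := by
  have h := card_le_of_forall_mem_eq (Finset.univ.image q ∪ Finset.univ.image q')
    (occurrences q c φ ∩ occurrences q' c φ') ?_
  · refine h.trans (le_of_eq ?_)
    have hi : Finset.univ.image q ∩ Finset.univ.image q' =
        (Finset.univ.filter fun d => q d = q' d).image q := by
      ext u
      simp only [Finset.mem_inter, Finset.mem_image, Finset.mem_univ, true_and,
        Finset.mem_filter]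
      constructor
      · rintro ⟨⟨d, rfl⟩, d', h⟩
        obtain rfl := hqq _ _ h.symm
        exact ⟨d, h.symm, rfl⟩
      · rintro ⟨d, h, rfl⟩
        exact ⟨⟨d, rfl⟩, d, h.symm⟩
    have hu := Finset.card_union_add_card_inter (Finset.univ.image q) (Finset.univ.image q')
    rw [hi, Finset.card_image_of_injective _ hq, Finset.card_image_of_injective _ hq,
      Finset.card_image_of_injective _ hq', Finset.card_univ, ← two_mul] at hu
    rw [← hu, pow_add]
    field_simp
  · intro x hx y hy u hu
    simp only [occurrences, Finset.mem_inter, Finset.mem_filter, Finset.mem_univ,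
      true_and] at hx hy
    simp only [Finset.mem_union, Finset.mem_image, Finset.mem_univ, true_and] at hu
    rcases hu with ⟨d, rfl⟩ | ⟨d, rfl⟩
    · rw [hx.1, hy.1]
    · rw [hx.2, hy.2]

theorem occurrences_inter_eq_empty {q q' : D → κ} {c : D → V} {φ φ' : V → α} {d : D}
    (hd : q d = q' d) (h : φ (c d) ≠ φ' (c d)) :
    occurrences q c φ ∩ occurrences q' c φ' = ∅ := by
  refine Finset.eq_empty_of_forall_notMem fun x hx => h ?_
  simp only [occurrences, Finset.mem_inter, Finset.mem_filter, Finset.mem_univ,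
    true_and] at hx
  rw [← hx.1, ← hx.2, hd]

/-- The letters of the parts of the pattern indexed by `I`. -/
noncomputable def partLetters (β : D → ι) (I : Finset ι) : Finset D :=
  Finset.univ.filter fun d => β d ∈ I

theorem mem_partLetters {β : D → ι} {I : Finset ι} {d : D} : d ∈ partLetters β I ↔ β d ∈ I := by
  simp [partLetters]

/-- The vertices visited by the parts of the pattern indexed by `I`. -/
noncomputable def partVerts (β : D → ι) (c : D → V) (I : Finset ι) : Finset V :=
  (partLetters β I).image c

theorem mem_partVerts {β : D → ι} {c : D → V} {I : Finset ι} {v : V} :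
    v ∈ partVerts β c I ↔ ∃ d, β d ∈ I ∧ c d = v := by
  simp [partVerts, mem_partLetters]

theorem card_partVerts_of_injective {c : D → V} (hc : Function.Injective c) (β : D → ι)
    (I : Finset ι) : (partVerts β c I).card = (partLetters β I).card :=
  Finset.card_image_of_injective _ hc

variable [Fintype V]

/-- The bound on the contribution of two choices of blocks that agree exactly on `I ≠ ∅`. -/
theorem sum_card_occurrences_inter_le [Nonempty α] {q q' : D → κ} (hq : Function.Injective q)
    (hq' : Function.Injective q') (hqq : ∀ d d', q d = q' d' → d = d') {β : D → ι} {c : D → V}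
    {I : Finset ι} (hI : ∀ d, q d = q' d ↔ β d ∈ I)
    (hforest : (partLetters β I).card + 1 ≤ (partVerts β c I).card + I.card)
    (F : Finset (V → α)) :
    ∑ φ ∈ F, ∑ φ' ∈ F, ((occurrences q c φ ∩ occurrences q' c φ').card : ℝ) ≤
      (Fintype.card α : ℝ) ^ Fintype.card κ * (Fintype.card α : ℝ) ^ (2 * Fintype.card V) /
        (Fintype.card α : ℝ) ^ (2 * Fintype.card D) *
          ((Fintype.card α : ℝ) ^ I.card / Fintype.card α) := by
  set n : ℝ := ((Fintype.card α : ℕ) : ℝ) with hn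
  have hn1 : 1 ≤ n := by rw [hn]; exact_mod_cast Fintype.card_pos
  have hn0 : 0 < n := by linarith
  set B : ℝ := n ^ Fintype.card κ *
    n ^ (partLetters β I).card / n ^ (2 * Fintype.card D) with hB
  have hB0 : 0 ≤ B := by positivity
  -- Shared blocks force `φ` and `φ'` to agree on the vertices visited there; otherwise no word
  -- contains both occurrences.
  have hle : ∀ φ φ' : V → α, ((occurrences q c φ ∩ occurrences q' c φ').card : ℝ) ≤
      if ∀ v ∈ partVerts β c I, φ' v = φ v then B else 0 := by
    intro φ φ'
    split_ifs with h
    · have := card_occurrences_inter_le hq hq' hqq c φ φ'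
      have hset : (Finset.univ.filter fun d => q d = q' d) = partLetters β I := by
        ext d
        simp [hI, mem_partLetters]
      rwa [hset] at this
    · simp only [mem_partVerts, not_forall] at h
      obtain ⟨_, ⟨d, hd, rfl⟩, hne⟩ := h
      rw [occurrences_inter_eq_empty ((hI d).2 hd) (Ne.symm hne)]
      simp
  calc _ ≤ ∑ φ ∈ F, ∑ φ' ∈ F, if ∀ v ∈ partVerts β c I, φ' v = φ v then B else 0 :=
        Finset.sum_le_sum fun φ _ => Finset.sum_le_sum fun φ' _ => hle φ φ'
    _ ≤ ∑ φ : V → α, ∑ φ' : V → α, if ∀ v ∈ partVerts β c I, φ' v = φ v then B else 0 := by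
        have h0 : ∀ φ φ' : V → α, 0 ≤ if ∀ v ∈ partVerts β c I, φ' v = φ v then B else 0 := by
          intro φ φ'
          split_ifs <;> simp [hB0]
        refine (Finset.sum_le_sum fun φ _ => Finset.sum_le_sum_of_subset_of_nonneg
          (Finset.subset_univ F) fun φ' _ _ => h0 φ φ').trans
          (Finset.sum_le_sum_of_subset_of_nonneg (Finset.subset_univ F)
            fun φ _ _ => Finset.sum_nonneg fun φ' _ => h0 φ φ')
    _ = (∑ φ : V → α, ((Finset.univ.filter fun φ' : V → α =>
          ∀ v ∈ partVerts β c I, φ' v = φ v).card : ℝ)) * B := by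
        rw [Finset.sum_mul]
        refine Finset.sum_congr rfl fun φ _ => ?_
        rw [← Finset.sum_filter, Finset.sum_const, nsmul_eq_mul]
    _ = n ^ (2 * Fintype.card V) / n ^ (partVerts β c I).card * B := by
        rw [sum_card_filter_forall_mem_eq]
    _ ≤ _ := by
        -- Sharing letters gains a power of `n` and agreeing on vertices loses one; `hforest` bounds
        -- the net gain by `n ^ (|I| - 1)`.
        have hp : n ^ (partLetters β I).card * n ≤
            n ^ (partVerts β c I).card * n ^ I.card := by
          rw [← pow_succ, ← pow_add]
          exact pow_le_pow_right₀ hn1 hforest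
        have hp' : n ^ (partLetters β I).card / n ^ (partVerts β c I).card ≤
            n ^ I.card / n := by
          rw [div_le_div_iff₀ (by positivity) hn0, mul_comm (n ^ I.card)]
          exact hp
        calc _ = n ^ Fintype.card κ * n ^ (2 * Fintype.card V) / n ^ (2 * Fintype.card D) *
              (n ^ (partLetters β I).card /
                n ^ (partVerts β c I).card) := by
              rw [hB]
              ring
          _ ≤ _ := by gcongr

variable [Fintype ι]

/-- If the blocks are chosen independently, the number of occurrences of the pattern is
concentrated. -/
theorem card_le_of_forall_notMem_occurrences [Nonempty α] {m : ℕ} (hm : 0 < m) (q : (ι → Fin m) → D → κ)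
    (β : D → ι) (c : D → V)
    (hq : ∀ j j' d d', q j d = q j' d' ↔ d = d' ∧ j (β d) = j' (β d'))
    (hforest : ∀ I : Finset ι, I.Nonempty →
      (partLetters β I).card + 1 ≤ (partVerts β c I).card + I.card)
    (F : Finset (V → α)) {K : ℝ} (hF : (Fintype.card α : ℝ) ^ Fintype.card V ≤ K * F.card)
    {A : Finset (κ → α)} (hA : ∀ x ∈ A, ∀ j, ∀ φ ∈ F, x ∉ occurrences (q j) c φ) :
    (A.card : ℝ) ≤ (Fintype.card α : ℝ) ^ Fintype.card κ *
        ∑ I ∈ Finset.univ.filter fun I : Finset ι => I.Nonempty,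
          K ^ 2 * ((Fintype.card α : ℝ) ^ I.card / (Fintype.card α * (m : ℝ) ^ I.card)) := by
  have : Nonempty (Fin m) := ⟨⟨0, hm⟩⟩
  set n : ℝ := ((Fintype.card α : ℕ) : ℝ) with hn
  have hn0 : 0 < n := by rw [hn]; exact_mod_cast Fintype.card_pos
  have hm0 : (0 : ℝ) < m := by exact_mod_cast hm
  have hF0 : (0 : ℝ) < F.card := by
    have h1 : 0 < n ^ Fintype.card V := by positivity
    have h2 : 0 < K * F.card := h1.trans_le hF
    rcases (Nat.cast_nonneg (α := ℝ) F.card).eq_or_lt with h | h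
    · rw [← h, mul_zero] at h2
      exact absurd h2 (lt_irrefl _)
    · exact h
  have hinj : ∀ j, Function.Injective (q j) := fun j d d' h => ((hq j j d d').1 h).1
  set k := Fintype.card ι
  set W := Fintype.card D
  set M : ℝ := (Fintype.card (ι → Fin m) : ℝ) with hM
  have hMm : M = (m : ℝ) ^ k := by simp [hM, k]
  set μ : ℝ := M * F.card / n ^ W with hμ
  have hM0 : 0 < M := by rw [hMm]; positivity
  have hμ0 : 0 < μ := by positivity
  let N : (κ → α) → ℝ := fun x => ∑ j, ∑ φ ∈ F, if x ∈ occurrences (q j) c φ then 1 else 0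
  have hsum : ∑ x, N x = Fintype.card (κ → α) * μ := by
    simp only [N]
    rw [Finset.sum_comm]
    have h1 : ∀ j, ∑ x : κ → α, ∑ φ ∈ F, (if x ∈ occurrences (q j) c φ then (1 : ℝ) else 0) =
        F.card * (n ^ Fintype.card κ / n ^ W) := by
      intro j
      rw [Finset.sum_comm, ← nsmul_eq_mul, ← Finset.sum_const]
      refine Finset.sum_congr rfl fun φ _ => ?_
      rw [← card_occurrences (hinj j) c φ]
      simp
    simp only [h1, Finset.sum_const, Finset.card_univ, nsmul_eq_mul]
    rw [hμ, hM, Fintype.card_fun (α := κ)]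
    push_cast
    ring
  have hN2 : ∑ x, N x ^ 2 = ∑ j, ∑ j', ∑ φ ∈ F, ∑ φ' ∈ F,
      ((occurrences (q j) c φ ∩ occurrences (q j') c φ').card : ℝ) := by
    have h1 : ∀ x, N x ^ 2 = ∑ j, ∑ j', ∑ φ ∈ F, ∑ φ' ∈ F,
        if x ∈ occurrences (q j) c φ ∩ occurrences (q j') c φ' then (1 : ℝ) else 0 := by
      intro x
      simp only [N, sq]
      rw [Finset.sum_mul_sum]
      refine Finset.sum_congr rfl fun j _ => Finset.sum_congr rfl fun j' _ => ?_
      rw [Finset.sum_mul_sum]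
      refine Finset.sum_congr rfl fun φ _ => Finset.sum_congr rfl fun φ' _ => ?_
      simp only [Finset.mem_inter]
      split_ifs <;> simp_all
    simp only [h1]
    rw [Finset.sum_comm]
    refine Finset.sum_congr rfl fun j _ => ?_
    rw [Finset.sum_comm]
    refine Finset.sum_congr rfl fun j' _ => ?_
    rw [Finset.sum_comm]
    refine Finset.sum_congr rfl fun φ _ => ?_
    rw [Finset.sum_comm]
    refine Finset.sum_congr rfl fun φ' _ => ?_
    rw [Finset.sum_boole, Finset.filter_univ_mem]
  let agree : (ι → Fin m) → (ι → Fin m) → Finset ι := fun j j' =>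
    Finset.univ.filter fun i => j' i = j i
  let B : ℝ := n ^ Fintype.card κ * n ^ (2 * Fintype.card V) / n ^ (2 * W)
  have hB0 : 0 ≤ B := by positivity
  -- Choices without a common block give the uncorrelated term. The others are charged to their
  -- agreement set, and the sum over all `I` on which they agree is an upper bound that is easy to
  -- count.
  have hpair : ∀ j j', ∑ φ ∈ F, ∑ φ' ∈ F,
      ((occurrences (q j) c φ ∩ occurrences (q j') c φ').card : ℝ) ≤
        n ^ Fintype.card κ * F.card ^ 2 / n ^ (2 * W) +
          ∑ I ∈ Finset.univ.filter fun I : Finset ι => I.Nonempty,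
            if ∀ i ∈ I, j' i = j i then B * (n ^ I.card / n) else 0 := by
    intro j j'
    have h0 : ∀ I : Finset ι, 0 ≤ if ∀ i ∈ I, j' i = j i then B * (n ^ I.card / n) else 0 := by
      intro I
      split_ifs <;> positivity
    have hqq : ∀ d d', q j d = q j' d' → d = d' := fun d d' h => ((hq j j' d d').1 h).1
    have hI : ∀ d, q j d = q j' d ↔ β d ∈ agree j j' := by
      intro d
      simp [agree, hq, eq_comm]
    rcases (agree j j').eq_empty_or_nonempty with he | hne
    · refine le_add_of_le_of_nonneg ?_ (Finset.sum_nonneg fun I _ => h0 I)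
      calc _ ≤ ∑ φ ∈ F, ∑ φ' ∈ F, n ^ Fintype.card κ / n ^ (2 * W) := by
            refine Finset.sum_le_sum fun φ _ => Finset.sum_le_sum fun φ' _ => ?_
            have := card_occurrences_inter_le (hinj j) (hinj j') hqq c φ φ'
            simpa [hI, he] using this
        _ = _ := by
            simp only [Finset.sum_const, nsmul_eq_mul]
            ring
    · refine le_add_of_nonneg_of_le (by positivity) ?_
      refine (sum_card_occurrences_inter_le (hinj j) (hinj j') hqq hI
        (hforest _ hne) F).trans ?_
      refine le_trans (le_of_eq ?_) (Finset.single_le_sum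
        (f := fun I : Finset ι => if ∀ i ∈ I, j' i = j i then B * (n ^ I.card / n) else 0)
        (fun I _ => h0 I) (Finset.mem_filter.2 ⟨Finset.mem_univ _, hne⟩))
      rw [if_pos]
      simp [agree]
  -- Summed over all pairs of choices, the uncorrelated term is exactly the square that Chebyshev's
  -- inequality subtracts.
  have hsecond : ∑ x, N x ^ 2 ≤ n ^ Fintype.card κ * μ ^ 2 +
      ∑ I ∈ Finset.univ.filter fun I : Finset ι => I.Nonempty,
        M ^ 2 / (m : ℝ) ^ I.card * (B * (n ^ I.card / n)) := by
    rw [hN2]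
    refine (Finset.sum_le_sum fun j _ => Finset.sum_le_sum fun j' _ => hpair j j').trans
      (le_of_eq ?_)
    simp only [Finset.sum_add_distrib]
    congr 1
    · simp only [Finset.sum_const, nsmul_eq_mul, Finset.card_univ]
      rw [hμ, ← hM]
      ring
    · have h1 : ∀ j : ι → Fin m, ∑ j' : ι → Fin m,
          ∑ I ∈ Finset.univ.filter fun I : Finset ι => I.Nonempty,
            (if ∀ i ∈ I, j' i = j i then B * (n ^ I.card / n) else 0) =
          ∑ I ∈ Finset.univ.filter fun I : Finset ι => I.Nonempty,
            ((Finset.univ.filter fun j' : ι → Fin m => ∀ i ∈ I, j' i = j i).card : ℝ) *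
              (B * (n ^ I.card / n)) := by
        intro j
        rw [Finset.sum_comm]
        refine Finset.sum_congr rfl fun I _ => ?_
        rw [← Finset.sum_filter, Finset.sum_const, nsmul_eq_mul]
      simp only [h1]
      rw [Finset.sum_comm]
      refine Finset.sum_congr rfl fun I _ => ?_
      have h2 := sum_card_filter_forall_mem_eq (κ := ι) (α := Fin m) I
      rw [Fintype.card_fin] at h2
      rw [← Finset.sum_mul, hMm, ← pow_mul, mul_comm _ 2, ← h2]
      congr!
  have hcheb := card_filter_eq_zero_mul_sq_le N μ hsum
  have hset : A ⊆ Finset.univ.filter fun x => N x = 0 := by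
    intro x hx
    simp only [Finset.mem_filter, Finset.mem_univ, true_and, N]
    exact Finset.sum_eq_zero fun j _ => Finset.sum_eq_zero fun φ hφ => if_neg (hA x hx j φ hφ)
  refine le_trans (Nat.cast_le.2 (Finset.card_le_card hset)) ?_
  rw [← mul_le_mul_iff_left₀ (pow_pos hμ0 2)]
  refine hcheb.trans ?_
  rw [Fintype.card_fun]
  push_cast
  rw [← hn]
  refine (sub_le_iff_le_add'.2 hsecond).trans ?_
  rw [mul_assoc, Finset.sum_mul, Finset.mul_sum]
  refine Finset.sum_le_sum fun I _ => ?_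
  -- The error terms were summed over all maps; the loss against the maps in `F`, which define `μ`,
  -- is at most `K ^ 2`.
  have hFK : n ^ (2 * Fintype.card V) ≤ K ^ 2 * (F.card : ℝ) ^ 2 := by
    rw [mul_comm 2, pow_mul, ← mul_pow]
    exact pow_le_pow_left₀ (by positivity) hF 2
  calc _ = (M ^ 2 / (m : ℝ) ^ I.card * (n ^ I.card / n) * n ^ Fintype.card κ / n ^ (2 * W)) *
        n ^ (2 * Fintype.card V) := by
        simp only [B]
        ring
    _ ≤ (M ^ 2 / (m : ℝ) ^ I.card * (n ^ I.card / n) * n ^ Fintype.card κ / n ^ (2 * W)) *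
        (K ^ 2 * (F.card : ℝ) ^ 2) := by gcongr
    _ = _ := by
        rw [hμ, mul_comm 2 W, pow_mul]
        field_simp

end SecondMoment

/-! ### Placing the trails of a forest in blocks of time. -/

section TrailPatterns

open Classical SimpleGraph

theorem exists_getVert_of_mem_edges {V : Type*} {G : SimpleGraph V} {a b : V} (p : G.Walk a b)
    {e : Sym2 V} (he : e ∈ p.edges) :
    ∃ k : Fin p.length, e = s(p.getVert k, p.getVert (k + 1)) := by
  induction p with
  | nil => simp at he
  | cons h p ih =>
    rw [Walk.edges_cons, List.mem_cons] at he
    rcases he with rfl | he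
    · exact ⟨⟨0, by simp⟩, by simp⟩
    · obtain ⟨k, hk⟩ := ih he
      exact ⟨⟨k + 1, by simp⟩, by simpa using hk⟩

/-- The position of letter `d` when block `j i` of the `i`th series of blocks is used. -/
def blockPos {ρ m L t : ℕ} {ℓ : Fin ρ → ℕ} (hL : ∀ i, ℓ i + 1 ≤ L) (ht : ρ * m * L ≤ t + 1)
    (j : Fin ρ → Fin m) (d : Σ i, Fin (ℓ i + 1)) : Fin (t + 1) :=
  Fin.castLE ht (finProdFinEquiv (finProdFinEquiv (d.1, j d.1), Fin.castLE (hL d.1) d.2))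

/-- Series, block and offset can be read off a position, so two choices of blocks share precisely
the letters of the series on which they agree. -/
theorem blockPos_eq_iff {ρ m L t : ℕ} {ℓ : Fin ρ → ℕ} (hL : ∀ i, ℓ i + 1 ≤ L)
    (ht : ρ * m * L ≤ t + 1) (j j' : Fin ρ → Fin m) (d d' : Σ i, Fin (ℓ i + 1)) :
    blockPos hL ht j d = blockPos hL ht j' d' ↔ d = d' ∧ j d.1 = j' d'.1 := by
  obtain ⟨i, k⟩ := d
  obtain ⟨i', k'⟩ := d'
  rw [blockPos, blockPos, (Fin.castLE_injective ht).eq_iff, finProdFinEquiv.injective.eq_iff,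
    Prod.mk.injEq, finProdFinEquiv.injective.eq_iff, Prod.mk.injEq]
  constructor
  · rintro ⟨⟨h1, h2⟩, h3⟩
    obtain rfl : i = i' := h1
    obtain rfl : k = k' := Fin.castLE_injective _ h3
    exact ⟨rfl, h2⟩
  · rintro ⟨h1, h2⟩
    obtain ⟨rfl, h⟩ := Sigma.mk.inj_iff.1 h1
    obtain rfl := eq_of_heq h
    exact ⟨⟨rfl, h2⟩, rfl⟩

theorem blockPos_succ {ρ m L t : ℕ} {ℓ : Fin ρ → ℕ} (hL : ∀ i, ℓ i + 1 ≤ L)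
    (ht : ρ * m * L ≤ t + 1) (j : Fin ρ → Fin m) (i : Fin ρ) (k : Fin (ℓ i)) :
    ∃ u : Fin t, blockPos hL ht j ⟨i, k.castSucc⟩ = u.castSucc ∧
      blockPos hL ht j ⟨i, k.succ⟩ = u.succ := by
  have h : (blockPos hL ht j ⟨i, k.succ⟩ : ℕ) = blockPos hL ht j ⟨i, k.castSucc⟩ + 1 := by
    simp [blockPos, finProdFinEquiv]
    ring
  have hlt := (blockPos hL ht j ⟨i, k.succ⟩).2
  exact ⟨⟨blockPos hL ht j ⟨i, k.castSucc⟩, by omega⟩, Fin.ext rfl, Fin.ext h⟩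

variable {V : Type*} {G : SimpleGraph V}

/-- Edges of a forest inside a non-empty set of `w` vertices number at most `w - 1`. -/
theorem IsAcyclic.card_add_one_le_of_subset (hG : G.IsAcyclic) {W : Finset V} (hW : W.Nonempty)
    {E : Finset (Sym2 V)} (hE : ∀ e ∈ E, e ∈ G.edgeSet) (hEW : ∀ e ∈ E, ∀ v ∈ e, v ∈ W) :
    E.card + 1 ≤ W.card := by
  have : Nonempty {v // v ∈ W} := hW.to_subtype
  have hac : (G.comap (Subtype.val : {v // v ∈ W} → V)).IsAcyclic :=
    hG.of_comap (Function.Embedding.subtype _)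
  have h1 := IsAcyclic.card_edgeFinset_lt hac
  rw [Fintype.card_coe] at h1
  refine le_trans (Nat.add_le_add_right ?_ 1) h1
  refine le_trans (Finset.card_le_card (t := (G.comap
    (Subtype.val : {v // v ∈ W} → V)).edgeFinset.image (Sym2.map Subtype.val)) ?_)
    Finset.card_image_le
  intro e he
  have h2 := hE e he
  have h3 := hEW e he
  induction e with
  | _ a b =>
    rw [Finset.mem_image]
    exact ⟨s(⟨a, h3 a (by simp)⟩, ⟨b, h3 b (by simp)⟩), by simpa using h2, by simp⟩

/-- A trail has one more letter than edges, so the letters number the edges plus `|I|`. The edges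
are distinct and form a forest on the visited vertices, which costs at least one more vertex than
edges. -/
theorem IsAcyclic.card_partLetters_add_one_le (hG : G.IsAcyclic) {r : ℕ}
    {a b : Fin r → V} {p : ∀ i, G.Walk (a i) (b i)} (hp : ∀ i, (p i).IsTrail)
    (hd : ∀ i j, i ≠ j → List.Disjoint (p i).edges (p j).edges) (I : Finset (Fin r))
    (hI : I.Nonempty) :
    (partLetters (Sigma.fst : (Σ i, Fin ((p i).length + 1)) → Fin r) I).card + 1 ≤
      (partVerts (Sigma.fst : (Σ i, Fin ((p i).length + 1)) → Fin r)
        (fun d => (p d.1).getVert d.2) I).card + I.card := by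
  have hcard : (partLetters (Sigma.fst : (Σ i, Fin ((p i).length + 1)) → Fin r) I).card =
      ∑ i ∈ I, (p i).length + I.card := by
    have h : partLetters (Sigma.fst : (Σ i, Fin ((p i).length + 1)) → Fin r) I =
        I.sigma fun _ => Finset.univ := by
      ext d
      simp [mem_partLetters]
    rw [h, Finset.card_sigma]
    simp [Finset.sum_add_distrib]
  have hE : (I.biUnion fun i => (p i).edges.toFinset).card = ∑ i ∈ I, (p i).length := by
    rw [Finset.card_biUnion]
    · refine Finset.sum_congr rfl fun i _ => ?_
      rw [List.toFinset_card_of_nodup (hp i).edges_nodup, Walk.length_edges]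
    · intro i _ j _ hij
      refine Finset.disjoint_left.2 fun e he he' => ?_
      rw [List.mem_toFinset] at he he'
      exact hd i j hij he he'
  rw [hcard, ← hE]
  suffices h : (I.biUnion fun i => (p i).edges.toFinset).card + 1 ≤ (partVerts
      (Sigma.fst : (Σ i, Fin ((p i).length + 1)) → Fin r)
        (fun d => (p d.1).getVert d.2) I).card by omega
  refine IsAcyclic.card_add_one_le_of_subset hG ?_ ?_ ?_
  · obtain ⟨i, hi⟩ := hI
    exact ⟨_, mem_partVerts.2 ⟨⟨i, 0⟩, hi, rfl⟩⟩
  · intro e he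
    simp only [Finset.mem_biUnion, List.mem_toFinset] at he
    obtain ⟨i, -, he⟩ := he
    exact (p i).edges_subset_edgeSet he
  · intro e he v hv
    simp only [Finset.mem_biUnion, List.mem_toFinset] at he
    obtain ⟨i, hi, he⟩ := he
    obtain ⟨k, hk, hkl⟩ := Walk.mem_support_iff_exists_getVert.1
      (Walk.mem_support_of_mem_edges he hv)
    exact mem_partVerts.2 ⟨⟨i, ⟨k, by omega⟩⟩, hi, hk⟩

variable [Fintype V]

/-- Each factor of the falling factorial is at least `n / 2`, so restricting to injective placements
loses only a constant factor. -/
theorem pow_card_le_mul_card_filter_injective {n : ℕ} (hn : 2 * Fintype.card V ≤ n) :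
    (n : ℝ) ^ Fintype.card V ≤ (2 : ℝ) ^ Fintype.card V *
      ((Finset.univ.filter fun φ : V → Fin n => Function.Injective φ).card : ℝ) := by
  have h : (Finset.univ.filter fun φ : V → Fin n => Function.Injective φ).card =
      n.descFactorial (Fintype.card V) := by
    rw [← Fintype.card_subtype, Fintype.card_congr (Equiv.subtypeInjectiveEquivEmbedding V (Fin n)),
      Fintype.card_embedding_eq, Fintype.card_fin]
  rw [h]
  calc (n : ℝ) ^ Fintype.card V ≤ ((2 * (n + 1 - Fintype.card V) : ℕ) : ℝ) ^ Fintype.card V := by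
        have : n ≤ 2 * (n + 1 - Fintype.card V) := by omega
        gcongr
    _ = (2 : ℝ) ^ Fintype.card V * (((n + 1 - Fintype.card V) ^ Fintype.card V : ℕ) : ℝ) := by
        push_cast
        rw [mul_pow]
    _ ≤ _ := by
        have := Nat.pow_sub_le_descFactorial n (Fintype.card V)
        gcongr

/-- The probability that no copy of a graph covered by `ρ` walks appears, provided that the walks
indexed by `I` together visit at least as many vertices as a forest with their edges has. -/
theorem one_sub_containProb_le {ρ : ℕ} {ℓ : Fin ρ → ℕ} {c : (Σ i, Fin (ℓ i + 1)) → V}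
    (hc : ∀ e ∈ G.edgeSet, ∃ i, ∃ k : Fin (ℓ i), e = s(c ⟨i, k.castSucc⟩, c ⟨i, k.succ⟩))
    (hforest : ∀ I : Finset (Fin ρ), I.Nonempty →
      (partLetters (Sigma.fst : (Σ i, Fin (ℓ i + 1)) → Fin ρ) I).card + 1 ≤
        (partVerts Sigma.fst c I).card + I.card)
    {m L t : ℕ} {n : ℕ+} (hL : ∀ i, ℓ i + 1 ≤ L) (ht : ρ * m * L ≤ t + 1) (hm : 0 < m)
    (hn : 2 * Fintype.card V ≤ n) :
    1 - containProb G n t ≤ ∑ I ∈ Finset.univ.filter fun I : Finset (Fin ρ) => I.Nonempty,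
      ((2 : ℝ) ^ Fintype.card V) ^ 2 * ((n : ℝ) ^ I.card / (n * (m : ℝ) ^ I.card)) := by
  have : Nonempty (Fin n) := ⟨⟨0, n.pos⟩⟩
  have hn0 : (0 : ℝ) < n := by exact_mod_cast n.pos
  let F := Finset.univ.filter fun φ : V → Fin n => Function.Injective φ
  have hF := pow_card_le_mul_card_filter_injective (V := V) hn
  have hmain := card_le_of_forall_notMem_occurrences hm (blockPos hL ht) Sigma.fst c
    (fun j j' d d' => blockPos_eq_iff hL ht j j' d d') hforest F
    (K := (2 : ℝ) ^ Fintype.card V) (by rwa [Fintype.card_fin])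
    (A := Finset.univ.filter fun x : Fin (t + 1) → Fin n => ¬ G ⊑ trace x) ?_
  · rw [Fintype.card_fin, Fintype.card_fin] at hmain
    have hcompl : ((Finset.univ.filter fun x : Fin (t + 1) → Fin n => G ⊑ trace x).card : ℝ) +
        (Finset.univ.filter fun x : Fin (t + 1) → Fin n => ¬ G ⊑ trace x).card =
          (n : ℝ) ^ (t + 1) := by
      rw [← Nat.cast_add, Finset.card_filter_add_card_filter_not]
      simp
    rw [containProb_eq, one_sub_div (by positivity), div_le_iff₀ (by positivity),
      ← eq_sub_of_add_eq' hcompl, mul_comm]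
    exact hmain
  · intro x hx
    simp only [Finset.mem_filter, Finset.mem_univ, true_and] at hx
    intro j φ hφ hocc
    replace hφ : Function.Injective φ := by simpa [F] using hφ
    simp only [occurrences, Finset.mem_filter, Finset.mem_univ, true_and] at hocc
    refine hx ⟨⟨⟨φ, fun {a b} hab => ?_⟩, hφ⟩⟩
    obtain ⟨i, k, hk⟩ := hc s(a, b) hab
    obtain ⟨u, hu1, hu2⟩ := blockPos_succ hL ht j i k
    refine trace_adj.2 ⟨⟨u, ?_⟩, fun h => hab.ne (hφ h)⟩
    rw [← hu1, ← hu2, hocc, hocc, ← Sym2.map_mk, ← Sym2.map_mk, hk]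

theorem containProb_le_one {W : Type*} (H : SimpleGraph W) (n : ℕ+) (t : ℕ) :
    containProb H n t ≤ 1 := by
  have hn0 : (0 : ℝ) < n := by exact_mod_cast n.pos
  rw [containProb_eq, div_le_one (by positivity)]
  have := Finset.card_filter_le (Finset.univ : Finset (Fin (t + 1) → Fin n))
    fun x => H ⊑ trace x
  rw [Finset.card_univ, Fintype.card_fun, Fintype.card_fin, Fintype.card_fin] at this
  exact_mod_cast this

end TrailPatterns

/-! ### Asymptotics on both sides of the threshold. -/

section Thresholds

open Classical SimpleGraph

theorem rpow_one_sub_inv_pow {x : ℝ} (hx : 0 < x) {a : ℕ} (ha : 1 ≤ a) :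
    (x ^ (1 - 1 / (a : ℝ))) ^ a = x ^ a / x := by
  have ha0 : (a : ℝ) ≠ 0 := by positivity
  rw [← Real.rpow_natCast, ← Real.rpow_mul hx.le, sub_mul, one_mul, one_div,
    inv_mul_cancel₀ ha0, Real.rpow_sub hx, Real.rpow_natCast, Real.rpow_one]

/-- This makes the exponent for `ρ` decisive on both sides: the first moment involves only `r ≥ ρ`,
the second only `|I| ≤ ρ`. -/
theorem rpow_one_sub_inv_le {x : ℝ} (hx : 1 ≤ x) {a b : ℕ} (ha : 1 ≤ a) (hab : a ≤ b) :
    x ^ (1 - 1 / (a : ℝ)) ≤ x ^ (1 - 1 / (b : ℝ)) := by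
  refine Real.rpow_le_rpow_of_exponent_le hx (sub_le_sub_left ?_ _)
  have : (0 : ℝ) < a := by exact_mod_cast ha
  gcongr

variable {V : Type*} [Fintype V] {G : SimpleGraph V}

theorem containProb_nonneg {W : Type*} (H : SimpleGraph W) (n : ℕ+) (t : ℕ) :
    0 ≤ containProb H n t :=
  ENNReal.toReal_nonneg

theorem tendsto_containProb_zero (T : SimpleGraph V)
    (hT : T.edgeFinset.card + 1 = Fintype.card V) {ρ : ℕ} (hρ1 : 1 ≤ ρ)
    (hρ : 2 * ρ ≤ oddCount T) {t : ℕ+ → ℕ}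
    (ht : MuchLess (fun n => (t n : ℝ)) fun n => ((n : ℕ) : ℝ) ^ (1 - 1 / (ρ : ℝ))) :
    Tendsto (fun n : ℕ+ => containProb T n (t n)) atTop (𝓝 0) := by
  refine squeeze_zero (fun n => containProb_nonneg _ _ _)
    (fun n => containProb_le T hT hρ n (t n)) ?_
  rw [← Finset.sum_const_zero (s := Finset.Icc ρ T.edgeFinset.card)]
  refine tendsto_finsetSum _ fun r hr => ?_
  rw [← mul_zero (((r * T.edgeFinset.card) ^ T.edgeFinset.card *
        (Fintype.card V * Fintype.card V) ^ T.edgeFinset.card : ℕ) : ℝ)]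
  refine Tendsto.const_mul _ ?_
  have hρr := (Finset.mem_Icc.1 hr).1
  have h := ht.pow r
  rw [zero_pow (by omega)] at h
  refine squeeze_zero (fun n => by positivity) (fun n => ?_) h
  have hn1 : (1 : ℝ) ≤ n := by exact_mod_cast one_le
  have hn0 : (0 : ℝ) < n := by linarith
  calc (t n : ℝ) ^ r * n / (n : ℝ) ^ r = (t n : ℝ) ^ r / ((n : ℝ) ^ r / n) := by
        field_simp
    _ = ((t n : ℝ) / (n : ℝ) ^ (1 - 1 / (r : ℝ))) ^ r := by
        rw [div_pow, rpow_one_sub_inv_pow hn0 (by omega)]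
    _ ≤ _ := by
        have := rpow_one_sub_inv_le hn1 hρ1 hρr
        have h0 : 0 < (n : ℝ) ^ (1 - 1 / (ρ : ℝ)) := by positivity
        gcongr

/-- Stated for any covering walks with the forest inequality, so that it serves both trail
decompositions and the explicit walk along a path. -/
theorem tendsto_containProb_one {ρ : ℕ} (hρ : 1 ≤ ρ) {ℓ : Fin ρ → ℕ}
    {c : (Σ i, Fin (ℓ i + 1)) → V}
    (hc : ∀ e ∈ G.edgeSet, ∃ i, ∃ k : Fin (ℓ i), e = s(c ⟨i, k.castSucc⟩, c ⟨i, k.succ⟩))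
    (hforest : ∀ I : Finset (Fin ρ), I.Nonempty →
      (partLetters (Sigma.fst : (Σ i, Fin (ℓ i + 1)) → Fin ρ) I).card + 1 ≤
        (partVerts Sigma.fst c I).card + I.card)
    {t : ℕ+ → ℕ}
    (ht : MuchGreater (fun n => (t n : ℝ)) fun n => ((n : ℕ) : ℝ) ^ (1 - 1 / (ρ : ℝ))) :
    Tendsto (fun n : ℕ+ => containProb G n (t n)) atTop (𝓝 1) := by
  obtain ⟨L, hL0, hL⟩ : ∃ L, 0 < L ∧ ∀ i, ℓ i + 1 ≤ L :=
    ⟨∑ i, ℓ i + 1, by omega, fun i =>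
      Nat.add_le_add_right (Finset.single_le_sum (fun _ _ => Nat.zero_le _)
        (Finset.mem_univ i)) 1⟩
  have hρL : 0 < ρ * L := by positivity
  let m : ℕ+ → ℕ := fun n => (t n + 1) / (ρ * L)
  have hmt : ∀ n, ρ * m n * L ≤ t n + 1 := fun n => by
    calc ρ * m n * L = ρ * L * m n := by ring
      _ ≤ _ := Nat.mul_div_le _ _
  -- Once a whole block fits in each series, rounding down loses at most a factor two, so `m` and
  -- `t` have the same order.
  have htm : ∀ n, 0 < m n → t n ≤ 2 * (ρ * L) * m n := fun n hn => by
    have h1 : t n + 1 < ρ * L * (m n + 1) := Nat.lt_mul_div_succ (t n + 1) hρL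
    have h2 : ρ * L ≤ ρ * L * m n := Nat.le_mul_of_pos_right _ hn
    nlinarith
  have hg1 : ∀ n : ℕ+, 1 ≤ ((n : ℕ) : ℝ) ^ (1 - 1 / (ρ : ℝ)) := fun n => by
    have hn1 : (1 : ℝ) ≤ n := by exact_mod_cast one_le
    simpa using rpow_one_sub_inv_le hn1 le_rfl hρ
  have htop : Tendsto (fun n => (t n : ℝ)) atTop atTop :=
    tendsto_atTop_mono (fun n => div_le_self (Nat.cast_nonneg _) (hg1 n)) ht
  have hlarge : ∀ᶠ n : ℕ+ in atTop, 2 * Fintype.card V ≤ (n : ℕ) :=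
    tendsto_PNat_val_atTop_atTop.eventually_ge_atTop _
  have hmpos : ∀ᶠ n : ℕ+ in atTop, 0 < m n := by
    filter_upwards [htop.eventually_ge_atTop ((ρ * L : ℕ) : ℝ)] with n hn
    have : ρ * L ≤ t n := by exact_mod_cast hn
    exact Nat.div_pos (by omega) hρL
  have hinv : Tendsto (fun n : ℕ+ => ((n : ℕ) : ℝ) ^ (1 - 1 / (ρ : ℝ)) / t n) atTop (𝓝 0) := by
    refine ht.inv_tendsto_atTop.congr fun n => ?_
    simp
  let S : ℕ+ → ℝ := fun n => ∑ I ∈ Finset.univ.filter fun I : Finset (Fin ρ) => I.Nonempty,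
    ((2 : ℝ) ^ Fintype.card V) ^ 2 * ((n : ℝ) ^ I.card / (n * (m n : ℝ) ^ I.card))
  have hS : Tendsto S atTop (𝓝 0) := by
    rw [← Finset.sum_const_zero (s := Finset.univ.filter fun I : Finset (Fin ρ) => I.Nonempty)]
    refine tendsto_finsetSum _ fun I hI => ?_
    have hI1 : 1 ≤ I.card := (Finset.mem_filter.1 hI).2.card_pos
    have hIρ : I.card ≤ ρ := by simpa using Finset.card_le_univ I
    rw [← mul_zero (((2 : ℝ) ^ Fintype.card V) ^ 2)]
    refine Tendsto.const_mul _ ?_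
    have h := (hinv.const_mul ((2 * (ρ * L) : ℕ) : ℝ)).pow I.card
    rw [mul_zero, zero_pow (by omega)] at h
    refine squeeze_zero' (Eventually.of_forall fun n => by positivity) ?_ h
    filter_upwards [hmpos, htop.eventually_gt_atTop 0] with n hn htn
    have hn1 : (1 : ℝ) ≤ n := by exact_mod_cast one_le
    have hn0 : (0 : ℝ) < n := by linarith
    have hm0 : (0 : ℝ) < m n := by exact_mod_cast hn
    have htm' : (t n : ℝ) ≤ ((2 * (ρ * L) : ℕ) : ℝ) * m n := by exact_mod_cast htm n hn
    calc (n : ℝ) ^ I.card / (n * (m n : ℝ) ^ I.card)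
        = ((n : ℝ) ^ (1 - 1 / (I.card : ℝ)) / m n) ^ I.card := by
          rw [div_pow, rpow_one_sub_inv_pow hn0 hI1, div_div]
      _ ≤ (((2 * (ρ * L) : ℕ) : ℝ) * ((n : ℝ) ^ (1 - 1 / (ρ : ℝ)) / t n)) ^ I.card := by
          have h1 := rpow_one_sub_inv_le hn1 hI1 hIρ
          have h2 : 0 ≤ (n : ℝ) ^ (1 - 1 / (I.card : ℝ)) := by positivity
          have h3 : 0 ≤ (n : ℝ) ^ (1 - 1 / (ρ : ℝ)) := by positivity
          refine pow_le_pow_left₀ (by positivity) ?_ _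
          rw [mul_div_assoc', div_le_div_iff₀ hm0 htn]
          calc _ ≤ (n : ℝ) ^ (1 - 1 / (ρ : ℝ)) * (((2 * (ρ * L) : ℕ) : ℝ) * m n) :=
                mul_le_mul h1 htm' htn.le h3
            _ = _ := by ring
  have hlow : Tendsto (fun n => 1 - S n) atTop (𝓝 1) := by
    simpa using hS.const_sub 1
  refine tendsto_of_tendsto_of_tendsto_of_le_of_le' hlow tendsto_const_nhds ?_
    (Eventually.of_forall fun n => containProb_le_one _ _ _)
  filter_upwards [hlarge, hmpos] with n hn hm
  have := one_sub_containProb_le hc hforest hL (hmt n) hm hn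
  simp only [S]
  linarith

theorem tendsto_containProb_one_of_isAcyclic (hG : G.IsAcyclic) {ρ : ℕ} (hρ : 1 ≤ ρ)
    (h : HasTrailDecomposition G ρ) {t : ℕ+ → ℕ}
    (ht : MuchGreater (fun n => (t n : ℝ)) fun n => ((n : ℕ) : ℝ) ^ (1 - 1 / (ρ : ℝ))) :
    Tendsto (fun n : ℕ+ => containProb G n (t n)) atTop (𝓝 1) := by
  obtain ⟨a, b, p, hp, hd, hc⟩ := h
  refine tendsto_containProb_one hρ (ℓ := fun i => (p i).length)
    (c := fun d => (p d.1).getVert d.2) (fun e he => ?_)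
    (IsAcyclic.card_partLetters_add_one_le hG hp hd) ht
  obtain ⟨i, hi⟩ := hc e he
  obtain ⟨k, hk⟩ := exists_getVert_of_mem_edges (p i) hi
  exact ⟨i, k, by simpa using hk⟩

theorem tendsto_containProb_pathGraph (k : ℕ) {t : ℕ+ → ℕ}
    (ht : MuchGreater (fun n => (t n : ℝ)) fun _ => 1) :
    Tendsto (fun n : ℕ+ => containProb (pathGraph (k + 1)) n (t n)) atTop (𝓝 1) := by
  refine tendsto_containProb_one (ρ := 1) le_rfl (ℓ := fun _ => k) (c := fun d => d.2)
    (fun e he => ?_) (fun I hI => ?_) (by simpa using ht)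
  · induction e with
    | _ a b =>
      rw [mem_edgeSet, pathGraph_adj] at he
      rcases he with h | h
      · refine ⟨0, ⟨a, by omega⟩, ?_⟩
        rw [Sym2.eq_iff]
        exact Or.inl ⟨Fin.ext rfl, Fin.ext (by simpa using h.symm)⟩
      · refine ⟨0, ⟨b, by omega⟩, ?_⟩
        rw [Sym2.eq_iff]
        exact Or.inr ⟨Fin.ext (by simpa using h.symm), Fin.ext rfl⟩
  -- The single walk repeats no vertex, so letters and visited vertices are equal in number and `1 ≤
  -- |I|` is all that remains.
  · refine Nat.add_le_add (le_of_eq ?_) hI.card_pos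
    refine (card_partVerts_of_injective ?_ _ _).symm
    rintro ⟨i, x⟩ ⟨j, y⟩ h
    obtain rfl := Subsingleton.elim i j
    obtain rfl : x = y := h
    rfl

theorem one_le_trailNumber (hT : G.IsTree) (hV : 2 ≤ Fintype.card V) : 1 ≤ trailNumber G := by
  by_contra hcon
  have h := hasTrailDecomposition_trailNumber hT.isAcyclic
  rw [Nat.lt_one_iff.1 (not_le.1 hcon)] at h
  obtain ⟨a, b, p, -, -, hc⟩ := h
  have h1 := hT.card_edgeFinset
  obtain ⟨e, he⟩ : G.edgeFinset.Nonempty := Finset.card_pos.1 (by omega)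
  obtain ⟨i, -⟩ := hc e (mem_edgeFinset.1 he)
  exact i.elim0

end Thresholds

end TraceOfWalk

theorem theorem4 :
    (∀ (V : Type*) [Fintype V] (T : SimpleGraph V), T.IsTree → 2 ≤ Fintype.card V →
      -- the two parameters determine each other
      TraceOfWalk.oddCount T = 2 * TraceOfWalk.trailNumber T ∧
      ∀ t : ℕ+ → ℕ,
        -- the threshold in terms of the number of odd-degree vertices
        (TraceOfWalk.MuchLess (fun n => (t n : ℝ))
            (fun n => ((n : ℕ) : ℝ) ^ (1 - 2 / (TraceOfWalk.oddCount T : ℝ))) →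
          Tendsto (fun n : ℕ+ => TraceOfWalk.containProb T n (t n)) atTop (𝓝 0)) ∧
        (TraceOfWalk.MuchGreater (fun n => (t n : ℝ))
            (fun n => ((n : ℕ) : ℝ) ^ (1 - 2 / (TraceOfWalk.oddCount T : ℝ))) →
          Tendsto (fun n : ℕ+ => TraceOfWalk.containProb T n (t n)) atTop (𝓝 1)) ∧
        -- the same threshold in terms of the trail decomposition number
        (TraceOfWalk.MuchLess (fun n => (t n : ℝ))
            (fun n => ((n : ℕ) : ℝ) ^ (1 - 1 / (TraceOfWalk.trailNumber T : ℝ))) →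
          Tendsto (fun n : ℕ+ => TraceOfWalk.containProb T n (t n)) atTop (𝓝 0)) ∧
        (TraceOfWalk.MuchGreater (fun n => (t n : ℝ))
            (fun n => ((n : ℕ) : ℝ) ^ (1 - 1 / (TraceOfWalk.trailNumber T : ℝ))) →
          Tendsto (fun n : ℕ+ => TraceOfWalk.containProb T n (t n)) atTop (𝓝 1))) ∧
    -- the path with `k` edges appears as soon as `t ≫ 1`
    (∀ (k : ℕ) (t : ℕ+ → ℕ), TraceOfWalk.MuchGreater (fun n => (t n : ℝ)) (fun _ => 1) →
      Tendsto (fun n : ℕ+ => TraceOfWalk.containProb (SimpleGraph.pathGraph (k + 1)) n (t n))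
        atTop (𝓝 1)) := by
  refine ⟨fun V _ T hT hV => ?_, fun k t ht => TraceOfWalk.tendsto_containProb_pathGraph k ht⟩
  classical
  have hodd := TraceOfWalk.oddCount_eq_two_mul_trailNumber hT.isAcyclic
  have hρ := TraceOfWalk.one_le_trailNumber hT hV
  have hexp : (2 : ℝ) / (TraceOfWalk.oddCount T : ℝ) = 1 / (TraceOfWalk.trailNumber T : ℝ) := by
    rw [hodd]
    push_cast
    field_simp
  have hcard := hT.card_edgeFinset
  have hzero := fun t : ℕ+ → ℕ => TraceOfWalk.tendsto_containProb_zero T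
    (by convert hcard) hρ hodd.ge (t := t)
  have hone := fun t : ℕ+ → ℕ => TraceOfWalk.tendsto_containProb_one_of_isAcyclic hT.isAcyclic hρ
    (TraceOfWalk.hasTrailDecomposition_trailNumber hT.isAcyclic) (t := t)
  rw [hexp]
  exact ⟨hodd, fun t => ⟨hzero t, hone t, hzero t, hone t⟩⟩
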